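/- **Setting.** A $K$-user common-message discrete memoryless broadcast channel has a finite input alphabet $\mathcal X$, finite output alphabets $\mathcal Y_k$ and stochastic matrices $W_k(y|x)$, $k\in\{1,\dots,K\}$; given the inputs, the outputs are independent over receivers and over time, so $P_{Y_k^n|X^n}(y^n|x^n)=\prod_{i=1}^n W_k(y_i|x_i)$. Let $\ell\ge 0$ be real, $M\ge1$ an integer and $\epsilon$ real. An $(\ell,M,\epsilon)$-VLSF (variable-length stop-feedback) code consists of: a random variable $U$ (common randomness) with values in a set $\mathcal U$, $|\mathcal U|\le K+1$; encoders $f_n:\mathcal U\times\{1,\dots,M\}\to\mathcal X$, $n\ge1$, giving the channel inputs $X_n=f_n(U,J)$, where the message $J$ is uniform on $\{1,\dots,M\}$ and independent of $U$; almost surely finite nonnegative integer-valued stopping times $\tau_k$ with respect to the filtrations $\sigma(U,Y_k^n)$, $n\ge0$, with $\mathbb E[\max_k\tau_k]\le\ell$; and decoders $g_{k,n}:\mathcal U\times\mathcal Y_k^n\to\{1,\dots,M\}$ with $\mathbb P[J\ne g_{k,\tau_k}(U,Y_k^{\tau_k})]\le\epsilon$ for every $k$. **Theorem.** Let $Q_k^{(\infty)}$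 be an arbitrary probability measure on $\mathcal Y_k^\infty$ for each $k$, and let $Q_k(y^n)$ be the $Q_k^{(\infty)}$-probability of the set of infinite sequences with prefix $y^n$. Put $i_k(x^n;y^n)=\log\frac{P_{Y_k^n|X^n}(y^n|x^n)}{Q_k(y^n)}\in[-\infty,\infty]$, equal to $0$ for $n=0$. For $M\ge 1$, $\eta>0$, $t\ge0$ and $\varepsilon_1,\dots,\varepsilon_K\in[0,1]$ let $$L_t(\varepsilon_1,\dots,\varepsilon_K)=\max_{x^t\in\mathcal X^t}\ \prod_{k=1}^K\min\Big\{1,\ \mathbb P\Big[\max_{0\le n\le t} i_k(x^n;Y_k^n)\ge\log M+\log\eta\Big]+\varepsilon_k\Big\},$$ where $Y_k^t\sim P_{Y_k^t|X^t=x^t}$, and $x^n$, $Y_k^n$ denote the first $n$ entries of $x^t$, $Y_k^t$. Then every $(\ell,M,\epsilon)$-VLSF code satisfies $$\ell\ \ge\ \min_{\substack{P_U,\ \varepsilon_k^{(u)}\in[0,1]:\\ \mathbb E[\varepsilon_k^{(U)}]\le\epsilon+\eta\ \text{for all } k}}\ \mathbb E\Big[\sum_{t=0}^\infty\Big(1-L_t\big(\varepsilon_1^{(U)},\dots,\varepsilon_K^{(U)}\big)\Big)\Big],$$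 where the minimum is over all probability distributions $P_U$ on a fixed set with $K+1$ elements and all families $\varepsilon_k^{(u)}$ indexed by its elements $u$; this minimum (in $[0,\infty]$) is attained. Moreover, it is not decreased by allowing arbitrary randomization, i.e. $U$ with values in an arbitrary measurable space and $\varepsilon_k^{(u)}$ measurable in $u$. -/

import Mathlib

open MeasureTheory
open scoped ENNReal NNReal

noncomputable section

namespace CMDMBC

variable {K : ℕ} {X : Type*} {Y : Fin K → Type*}

/-! ### Channel, output measures and information density

A `K`-user common-message discrete memoryless broadcast channel with finite input alphabet `X` and
finite output alphabets `Y k` is a family of stochastic matrices `W k : X → PMF (Y k)`. Given the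
inputs, the outputs are independent over time and over the receivers. Time starts at `0` in Lean:
the entry with index `i` of a sequence is its `(i + 1)`-st symbol. -/

/-- `P_{Y_k^n | X^n}(yⁿ | xⁿ) = ∏ᵢ W_k(yᵢ | xᵢ)`. -/
def channelProb (W : ∀ k, X → PMF (Y k)) (k : Fin K) {n : ℕ}
    (x : Fin n → X) (y : Fin n → Y k) : ℝ≥0∞ :=
  ∏ i, W k (x i) (y i)

/-- `Q_k(yⁿ)`: the probability under `Q_k^(∞)` of the infinite sequences with prefix `yⁿ`. -/
def prefixProb {B : Type*} [MeasurableSpace B] (Q : Measure (ℕ → B)) {n : ℕ} (y : Fin n → B) :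
    ℝ≥0∞ :=
  Q {z | ∀ i : Fin n, z i = y i}

variable [∀ k, MeasurableSpace (Y k)]

/-- The mismatched information density `i_k(xⁿ; yⁿ) = log (P_{Y_k^n | X^n}(yⁿ | xⁿ) / Q_k(yⁿ))`,
an extended real number (`+∞` if only the denominator vanishes). For `n = 0` it equals `0`
when `Q k` is a probability measure. -/
def infoDensity (W : ∀ k, X → PMF (Y k)) (Q : ∀ k, Measure (ℕ → Y k)) (k : Fin K) {n : ℕ}
    (x : Fin n → X) (y : Fin n → Y k) : EReal :=
  ENNReal.log (channelProb W k x y / prefixProb (Q k) y)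

/-- The law of `Y_k^t` given `X^t = xᵗ`. -/
def blockLaw (W : ∀ k, X → PMF (Y k)) (k : Fin K) {t : ℕ} (x : Fin t → X) :
    Measure (Fin t → Y k) :=
  Measure.pi fun i => (W k (x i)).toMeasure

/-- The probability `P[max_{0 ≤ n ≤ t} i_k(xⁿ; Y_k^n) ≥ log M + log η]`, `Y_k^t` having law
`P_{Y_k^t | X^t = xᵗ}`. -/
def crossingProb (W : ∀ k, X → PMF (Y k)) (Q : ∀ k, Measure (ℕ → Y k)) (M : ℕ) (η : ℝ)
    (k : Fin K) {t : ℕ} (x : Fin t → X) : ℝ :=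
  (blockLaw W k x).real
    {y | ((Real.log M + Real.log η : ℝ) : EReal) ≤
      ⨆ n : Fin (t + 1), infoDensity W Q k
        (Fin.take n (Nat.lt_succ_iff.mp n.isLt) x) (Fin.take n (Nat.lt_succ_iff.mp n.isLt) y)}

/-- `L_t(e_1, …, e_K)`; the supremum is over the finite set `Xᵗ`. -/
def L (W : ∀ k, X → PMF (Y k)) (Q : ∀ k, Measure (ℕ → Y k)) (M : ℕ) (η : ℝ) (t : ℕ)
    (e : Fin K → ℝ) : ℝ :=
  ⨆ x : Fin t → X, ∏ k, min 1 (crossingProb W Q M η k x + e k)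

/-- The values of the objective `E[∑_{t ≥ 0} (1 - L_t(e_1^(U), …, e_K^(U)))]` over all feasible
points of the minimization problem whose randomization `U` takes its values in `𝒱`: all probability
measures `P` on `𝒱` and all (measurable) families `e_k^(u) ∈ [0, 1]` with
`E[e_k^(U)] ≤ ε + η` for every `k`. -/
def converseValues (W : ∀ k, X → PMF (Y k)) (Q : ∀ k, Measure (ℕ → Y k)) (M : ℕ) (η ε : ℝ)
    (𝒱 : Type*) [MeasurableSpace 𝒱] : Set ℝ≥0∞ :=
  {v | ∃ (P : Measure 𝒱) (e : 𝒱 → Fin K → ℝ), IsProbabilityMeasure P ∧ Measurable e ∧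
    (∀ u k, e u k ∈ Set.Icc (0 : ℝ) 1) ∧ (∀ k, ∫ u, e u k ∂P ≤ ε + η) ∧
    v = ∫⁻ u, ∑' t : ℕ, ENNReal.ofReal (1 - L W Q M η t (e u)) ∂P}

/-! ### Variable-length stop-feedback codes -/

/-- The sample space of a code: common randomness, message, and all the channel outputs. -/
abbrev Sample (𝒰 : Type*) (M : ℕ) (Y : Fin K → Type*) : Type _ :=
  𝒰 × Fin M × (∀ k, ℕ → Y k)

/-- The joint law of `(U, J, (Y_k^∞)_k)`: `U` has law `PU`, the message `J` is uniform and
independent of `U`, and given `(U, J) = (u, j)` the outputs `Y_{k,n}` are independent over `k` and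
`n` with `Y_{k,n}` of law `W_k(· | f_n(u, j))`. -/
def codeLaw {𝒰 : Type*} [Fintype 𝒰] [MeasurableSpace 𝒰] {M : ℕ}
    (W : ∀ k, X → PMF (Y k)) (PU : PMF 𝒰) (f : ℕ → 𝒰 → Fin M → X) : Measure (Sample 𝒰 M Y) :=
  ∑ u, ∑ j, (PU u * (M : ℝ≥0∞)⁻¹) •
    (Measure.pi fun k => Measure.infinitePi fun n : ℕ => (W k (f n u j)).toMeasure).map
      fun y => (u, j, y)

/-- What receiver `k` knows at time `n`: the pair `(U, Y_k^n)`. -/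
def observation (𝒰 : Type*) (M : ℕ) (Y : Fin K → Type*) (k : Fin K) (n : ℕ)
    (ω : Sample 𝒰 M Y) : 𝒰 × (Fin n → Y k) :=
  (ω.1, fun i => ω.2.2 k i)

/-- The filtration `F_{k,n} = σ(U, Y_k^n)`. -/
def receiverFiltration (𝒰 : Type*) [MeasurableSpace 𝒰] (M : ℕ) (Y : Fin K → Type*)
    [∀ k, MeasurableSpace (Y k)] (k : Fin K) :
    Filtration ℕ (inferInstance : MeasurableSpace (Sample 𝒰 M Y)) where
  seq n := MeasurableSpace.comap (observation 𝒰 M Y k n) inferInstance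
  mono' := by
    intro m n hmn
    have h : observation 𝒰 M Y k m =
        (fun p : 𝒰 × (Fin n → Y k) => (p.1, fun i : Fin m => p.2 (Fin.castLE hmn i))) ∘
          observation 𝒰 M Y k n := rfl
    have hmeas : Measurable
        (fun p : 𝒰 × (Fin n → Y k) => (p.1, fun i : Fin m => p.2 (Fin.castLE hmn i))) := by
      fun_prop
    show MeasurableSpace.comap (observation 𝒰 M Y k m) inferInstance ≤
      MeasurableSpace.comap (observation 𝒰 M Y k n) inferInstance
    rw [h, ← MeasurableSpace.comap_comp]
    exact MeasurableSpace.comap_mono hmeas.comap_le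
  le' := by
    intro n
    apply Measurable.comap_le
    unfold observation
    fun_prop

/-- An `(ℓ, M, ε)`-VLSF code for the channel `W` whose common randomness takes its values in `𝒰`. The
stopping times may take the value `∞`; by `average_le` this has probability zero. -/
structure VLSFCode (W : ∀ k, X → PMF (Y k)) (𝒰 : Type*) [Fintype 𝒰] [MeasurableSpace 𝒰]
    (ℓ : ℝ≥0) (M : ℕ) (ε : ℝ) where
  /-- `𝒰` has at most `K + 1` elements -/
  card_le : Fintype.card 𝒰 ≤ K + 1
  /-- the law of the common randomness `U` -/
  PU : PMF 𝒰
  /-- the encoders: the channel input at time `n + 1` is `enc n U J` -/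
  enc : ℕ → 𝒰 → Fin M → X
  /-- the stopping time of each receiver -/
  τ : Fin K → Sample 𝒰 M Y → ℕ∞
  /-- the decoders `g_{k,n} : 𝒰 × Y_k^n → {1, …, M}` -/
  dec : ∀ (k : Fin K) (n : ℕ), 𝒰 × (Fin n → Y k) → Fin M
  /-- `τ k` is a stopping time for `σ(U, Y_k^n)` -/
  isStoppingTime : ∀ k, IsStoppingTime (receiverFiltration 𝒰 M Y k) (τ k)
  /-- `E[max_k τ_k] ≤ ℓ` -/
  average_le : ∫⁻ ω, ⨆ k, (τ k ω : ℝ≥0∞) ∂(codeLaw W PU enc) ≤ ℓ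
  /-- `P[J ≠ g_{k,τ_k}(U, Y_k^{τ_k})] ≤ ε` for every `k` -/
  error_le : ∀ k, (codeLaw W PU enc).real
    {ω | ¬ ∃ n : ℕ, τ k ω = n ∧ dec k n (observation 𝒰 M Y k n ω) = ω.2.1} ≤ ε

end CMDMBC

end

/-!
A code is turned into a feasible point of the minimization problem by randomizing over the pair
`(U, J)` of common randomness and message. For `(u, j)`, let `e_k` be the probability that receiver
`k` stops while its information density is below `log M + log η`. A receiver that has stopped by
time `t` has either stopped below the threshold or crossed it by time `t`, and given `(u, j)` the
receivers stop independently, so all of them have stopped by time `t` with probability at most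
`L_t(e)`; summing the tails over `t` bounds the objective by `E[max_k τ_k]`
(`tsum_le_lintegral_iSup`). The constraint on `E[e_k]` is a change of measure at the stopping time
(`IsSequenceStopping.measure_le`): below the threshold `P ≤ M η Q`, so stopping below the threshold
and decoding `j` has probability at most `M η` times the `Q_k`-probability of decoding `j`. The
decoding events for different `j` are disjoint, so averaging over `j` contributes at most `η`, and
decoding errors contribute the remaining `ε`.

The reduction to `K + 1` values of the randomization is Carathéodory's argument in dimension `K`
rather than `K + 1`: any affine relation among more than `K + 1` points `e_u` can be followed in the
direction in which the objective does not increase, until a weight vanishes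
(`exists_card_le_sum_le`). It is applied to the sums over `t < T`, which are continuous, so that the
set on and above the lower boundary of the convex hull is closed and contains barycenters of
arbitrary probability measures (`integral_mem_epiHull`). The resulting points for different `T` lie
in nested nonempty compact sets, and a common point handles the infinite sum
(`exists_feasible_finiteCost_le`). The minimum is attained because the objective is lower
semicontinuous on the compact set of feasible points.
-/

noncomputable section

namespace CMDMBC

/-! ### Carathéodory's theorem along the lower boundary of a graph -/

/-- More than `dim V + 1` points satisfy a nontrivial affine relation; up to its sign, the relation
pairs nonnegatively with `φ`. -/
theorem exists_affine_relation {V ι : Type*} [AddCommGroup V] [Module ℝ V] [FiniteDimensional ℝ V]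
    (z : ι → V) (φ : ι → ℝ) (t : Finset ι) (ht : Module.finrank ℝ V + 1 < t.card) :
    ∃ g : ι → ℝ, ∑ i ∈ t, g i • z i = 0 ∧ ∑ i ∈ t, g i = 0 ∧ (∃ i ∈ t, 0 < g i) ∧
      0 ≤ ∑ i ∈ t, g i * φ i := by
  have hdep : ¬ LinearIndependent ℝ fun i : t => (z i, (1 : ℝ)) := by
    intro h
    have := h.fintype_card_le_finrank
    simp at this
    omega
  obtain ⟨g, hg, i₀, hi₀⟩ := Fintype.not_linearIndependent_iff.1 hdep
  have hz : ∑ i : t, g i • z i = 0 := by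
    simpa [Prod.fst_sum] using congrArg Prod.fst hg
  have h1 : ∑ i : t, g i = 0 := by
    simpa [Prod.snd_sum] using congrArg Prod.snd hg
  classical
  -- it remains to extend a relation with the right sign by zero outside of `t`
  have key : ∀ c : t → ℝ, ∑ i : t, c i • z i = 0 → ∑ i : t, c i = 0 → c i₀ ≠ 0 →
      0 ≤ ∑ i : t, c i * φ i →
      ∃ g : ι → ℝ, ∑ i ∈ t, g i • z i = 0 ∧ ∑ i ∈ t, g i = 0 ∧ (∃ i ∈ t, 0 < g i) ∧
        0 ≤ ∑ i ∈ t, g i * φ i := by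
    intro c hc hs h0 hφ
    refine ⟨fun i => if h : i ∈ t then c ⟨i, h⟩ else 0, ?_, ?_, ?_, ?_⟩
    · rw [← Finset.sum_coe_sort]; simpa using hc
    · rw [← Finset.sum_coe_sort]; simpa using hs
    · obtain ⟨i, -, hi⟩ := Finset.exists_pos_of_sum_zero_of_exists_nonzero c hs
        ⟨i₀, Finset.mem_univ _, h0⟩
      exact ⟨i, i.2, by simpa using hi⟩
    · rw [← Finset.sum_coe_sort]; simpa using hφ
  rcases le_total 0 (∑ i : t, g i * φ i) with h | h
  · exact key g hz h1 hi₀ h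
  · refine key (fun i => -g i) ?_ ?_ (by simpa using hi₀) ?_
    · simp only [neg_smul, Finset.sum_neg_distrib, hz, neg_zero]
    · simp only [Finset.sum_neg_distrib, h1, neg_zero]
    · simpa using h

/-- Carathéodory's reduction along the lower boundary of the convex hull of a graph: `dim V + 1`
points suffice if the value of `φ` may decrease. -/
theorem exists_card_le_sum_le {V ι : Type*} [AddCommGroup V] [Module ℝ V] [FiniteDimensional ℝ V]
    (z : ι → V) (φ : ι → ℝ) (t : Finset ι) (w : ι → ℝ) (hw : ∀ i ∈ t, 0 ≤ w i) :
    ∃ (s : Finset ι) (w' : ι → ℝ), s.card ≤ Module.finrank ℝ V + 1 ∧ (∀ i ∈ s, 0 ≤ w' i) ∧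
      ∑ i ∈ s, w' i = ∑ i ∈ t, w i ∧ ∑ i ∈ s, w' i • z i = ∑ i ∈ t, w i • z i ∧
      ∑ i ∈ s, w' i * φ i ≤ ∑ i ∈ t, w i * φ i := by
  classical
  induction hn : t.card using Nat.strong_induction_on generalizing t w with
  | _ n ih =>
  by_cases hcard : t.card ≤ Module.finrank ℝ V + 1
  · exact ⟨t, w, hcard, hw, rfl, rfl, le_rfl⟩
  obtain ⟨g, gz, g1, ⟨i₁, hi₁, hgi₁⟩, gφ⟩ := exists_affine_relation z φ t (by omega)
  obtain ⟨i₀, hi₀, hmin⟩ := (t.filter (0 < g ·)).exists_min_image (fun i => w i / g i)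
    ⟨i₁, by simp [hi₁, hgi₁]⟩
  rw [Finset.mem_filter] at hi₀
  -- the largest step along `-g` that keeps all the weights nonnegative; it kills the weight `i₀`
  set a := w i₀ / g i₀ with ha
  have ha0 : 0 ≤ a := div_nonneg (hw _ hi₀.1) hi₀.2.le
  have h0 : w i₀ - a * g i₀ = 0 := by rw [ha]; field_simp [hi₀.2.ne']; ring
  obtain ⟨s, w', h1, h2, h3, h4, h5⟩ := ih (t.erase i₀).card
    (by rw [← hn]; exact Finset.card_erase_lt_of_mem hi₀.1) (t.erase i₀) (fun i => w i - a * g i)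
    (by
      intro i hi
      have hit := Finset.mem_of_mem_erase hi
      rcases lt_or_ge 0 (g i) with hgi | hgi
      · have := hmin i (by simp [hit, hgi])
        rw [le_div_iff₀ hgi] at this
        linarith
      · nlinarith [hw i hit, mul_nonneg ha0 (neg_nonneg.2 hgi)]) rfl
  refine ⟨s, w', h1, h2, h3.trans ?_, h4.trans ?_, h5.trans ?_⟩
  · rw [Finset.sum_erase (f := fun i => w i - a * g i) _ h0, Finset.sum_sub_distrib,
      ← Finset.mul_sum, g1]
    ring
  · rw [Finset.sum_erase _ (by rw [h0, zero_smul])]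
    simp only [sub_smul, mul_smul]
    rw [Finset.sum_sub_distrib, ← Finset.smul_sum, gz]; simp
  · rw [Finset.sum_erase _ (by rw [h0, zero_mul])]
    have : ∑ i ∈ t, (w i - a * g i) * φ i = ∑ i ∈ t, w i * φ i - a * ∑ i ∈ t, g i * φ i := by
      rw [Finset.mul_sum, ← Finset.sum_sub_distrib]
      exact Finset.sum_congr rfl fun i _ => by ring
    rw [this]
    nlinarith [mul_nonneg ha0 gφ]

/-- Randomizations with values in `[0, 1]^K` that take at most `N` values: a probability vector
and the values. -/
def finiteRandomizations (N K : ℕ) : Set ((Fin N → ℝ) × (Fin N → Fin K → ℝ)) :=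
  stdSimplex ℝ (Fin N) ×ˢ Set.pi Set.univ fun _ => Set.Icc 0 1

theorem isCompact_finiteRandomizations (N K : ℕ) : IsCompact (finiteRandomizations N K) :=
  (isCompact_stdSimplex ℝ (Fin N)).prod (isCompact_univ_pi fun _ => isCompact_Icc)

/-- The set on and above the lower boundary of the convex hull of the graph of `φ` over the cube,
as described by combinations of `K + 1` points. -/
def epiHull {K : ℕ} (φ : (Fin K → ℝ) → ℝ) : Set ((Fin K → ℝ) × ℝ) :=
  {q | ∃ θ ∈ finiteRandomizations (K + 1) K,
    ∑ u, θ.1 u • θ.2 u = q.1 ∧ ∑ u, θ.1 u * φ (θ.2 u) ≤ q.2}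

open scoped Pointwise in
theorem isClosed_epiHull {K : ℕ} {φ : (Fin K → ℝ) → ℝ} (hφ : Continuous φ) :
    IsClosed (epiHull φ) := by
  -- a compact set plus the closed upward half-line
  have h : epiHull φ = (fun θ : (Fin (K + 1) → ℝ) × (Fin (K + 1) → Fin K → ℝ) =>
      (∑ u, θ.1 u • θ.2 u, ∑ u, θ.1 u * φ (θ.2 u))) '' finiteRandomizations (K + 1) K +
        {q : (Fin K → ℝ) × ℝ | q.1 = 0 ∧ 0 ≤ q.2} := by
    ext ⟨x, r⟩
    simp only [epiHull, Set.mem_ofPred_eq, Set.mem_add, Set.exists_mem_image]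
    refine exists_congr fun θ => and_congr_right fun _ => ⟨fun h => ?_, ?_⟩
    · exact ⟨(0, r - ∑ u, θ.1 u * φ (θ.2 u)), ⟨rfl, sub_nonneg.2 h.2⟩, by simp [h.1]⟩
    · rintro ⟨⟨y, s⟩, ⟨rfl, hs⟩, he⟩
      rw [Prod.mk_add_mk, Prod.mk.injEq] at he
      simp only at hs
      exact ⟨by simpa using he.1, by linarith [he.2]⟩
  rw [h]
  refine IsClosed.add_left_of_isCompact ?_ ((isCompact_finiteRandomizations _ _).image ?_)
  · exact (isClosed_eq continuous_fst continuous_const).inter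
      (isClosed_le continuous_const continuous_snd)
  · fun_prop

theorem convexHull_subset_epiHull {K : ℕ} (φ : (Fin K → ℝ) → ℝ) :
    convexHull ℝ ((fun x => (x, φ x)) '' Set.Icc (0 : Fin K → ℝ) 1) ⊆ epiHull φ := by
  classical
  rintro q hq
  obtain ⟨ι, _, w, z, hw, hw1, hz, rfl⟩ := mem_convexHull_iff_exists_fintype.1 hq
  choose x hx hxz using hz
  obtain ⟨s, w', hs, hw', h1, h2, h3⟩ := exists_card_le_sum_le x (fun i => φ (x i)) Finset.univ w
    (fun i _ => hw i)
  rw [Module.finrank_fin_fun] at hs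
  -- embed the index set `s` into `Fin (K + 1)`, with weight `0` outside of the range
  obtain ⟨f⟩ : Nonempty (s ↪ Fin (K + 1)) :=
    Function.Embedding.nonempty_of_card_le (by simpa using hs)
  let p : Fin (K + 1) → ℝ := Function.extend f (fun i => w' i) 0
  let e : Fin (K + 1) → Fin K → ℝ := Function.extend f (fun i => x i) 0
  have hsum : ∀ {E : Type} [AddCommGroup E] [Module ℝ E] (F : (Fin K → ℝ) → E),
      ∑ u, p u • F (e u) = ∑ i ∈ s, w' i • F (x i) := by
    intro E _ _ F
    rw [← Finset.sum_coe_sort s, ← Finset.sum_subset (Finset.subset_univ (Finset.univ.map f)),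
      Finset.sum_map]
    · simp [p, e, f.injective.extend_apply]
    · intro u _ hu
      have : ¬ ∃ i, f i = u := by simpa using hu
      simp [p, Function.extend_apply' _ _ _ this]
  refine ⟨(p, e), ⟨⟨?_, ?_⟩, ?_⟩, ?_, ?_⟩
  · intro u
    by_cases hu : ∃ i, f i = u
    · obtain ⟨i, rfl⟩ := hu
      simpa [p, f.injective.extend_apply] using hw' i i.2
    · simp [p, Function.extend_apply' _ _ _ hu]
  · simpa [h1, hw1] using hsum (fun _ => (1 : ℝ))
  · intro u _
    by_cases hu : ∃ i, f i = u
    · obtain ⟨i, rfl⟩ := hu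
      simpa [e, f.injective.extend_apply] using hx i
    · simp only [e, Function.extend_apply' _ _ _ hu]
      exact ⟨le_rfl, zero_le_one⟩
  · have := hsum (fun x => x)
    simp only [this, h2, Prod.fst_sum, ← hxz, Prod.smul_mk]
  · have := hsum φ
    simp only [smul_eq_mul] at this
    simpa only [this, Prod.snd_sum, ← hxz, Prod.smul_mk, smul_eq_mul] using h3

/-- The barycenter of the graph of `φ` under an arbitrary probability measure. -/
theorem integral_mem_epiHull {K : ℕ} {φ : (Fin K → ℝ) → ℝ} (hφ : Continuous φ) {𝒱 : Type*}
    [MeasurableSpace 𝒱] (P : Measure 𝒱) [IsProbabilityMeasure P] {e : 𝒱 → Fin K → ℝ}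
    (he : Measurable e) (he01 : ∀ u, e u ∈ Set.Icc (0 : Fin K → ℝ) 1) :
    ((fun k => ∫ u, e u k ∂P), ∫ u, φ (e u) ∂P) ∈ epiHull φ := by
  obtain ⟨C, hC⟩ := (isCompact_Icc (a := (0 : Fin K → ℝ)) (b := 1)).exists_bound_of_continuousOn
    (f := fun x => (x, φ x)) (by fun_prop)
  have hint : Integrable (fun u => (e u, φ (e u))) P :=
    Integrable.of_bound (by fun_prop) C (ae_of_all _ fun u => hC _ (he01 u))
  have hmem := (convex_convexHull ℝ ((fun x => (x, φ x)) '' Set.Icc (0 : Fin K → ℝ) 1)).closure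
    |>.integral_mem isClosed_closure (ae_of_all P fun u =>
      subset_closure (subset_convexHull ℝ _ (Set.mem_image_of_mem _ (he01 u)))) hint
  have hmem' := closure_minimal (convexHull_subset_epiHull φ) (isClosed_epiHull hφ) hmem
  have h1 : ∫ u, (e u, φ (e u)) ∂P = (∫ u, e u ∂P, ∫ u, φ (e u) ∂P) :=
    integral_pair hint.fst hint.snd
  have h2 : ∫ u, e u ∂P = fun k => ∫ u, e u k ∂P := by
    ext k
    exact eval_integral (fun k => hint.fst.eval k) k
  rw [h1, h2] at hmem'
  exact hmem'

/-! ### Reduction to finitely many values and attainment of the minimum -/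

/-- The objective `∑_t ∑_u p_u ψ_t(e_u)` at a finite randomization `(p, e)`. -/
def finiteCost {N K : ℕ} (ψ : ℕ → (Fin K → ℝ) → ℝ≥0)
    (θ : (Fin N → ℝ) × (Fin N → Fin K → ℝ)) : ℝ≥0∞ :=
  ∑' t, ENNReal.ofReal (∑ u, θ.1 u * ψ t (θ.2 u))

/-- The finite randomizations `(p, e)` with `∑_u p_u e_u ≤ b` in every coordinate. -/
def feasibleRandomizations (N K : ℕ) (b : ℝ) : Set ((Fin N → ℝ) × (Fin N → Fin K → ℝ)) :=
  finiteRandomizations N K ∩ {θ | ∀ k, ∑ u, θ.1 u * θ.2 u k ≤ b}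

theorem isCompact_feasibleRandomizations (N K : ℕ) (b : ℝ) :
    IsCompact (feasibleRandomizations N K b) := by
  refine (isCompact_finiteRandomizations N K).inter_right ?_
  simp only [Set.ofPred_forall]
  exact isClosed_iInter fun k => isClosed_le (by fun_prop) continuous_const

theorem lowerSemicontinuous_finiteCost {N K : ℕ} {ψ : ℕ → (Fin K → ℝ) → ℝ≥0}
    (hψ : ∀ t, Continuous (ψ t)) : LowerSemicontinuous (finiteCost (N := N) ψ) :=
  lowerSemicontinuous_tsum fun t => by
    have := hψ t
    exact (ENNReal.continuous_ofReal.comp (by fun_prop)).lowerSemicontinuous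

/-- A randomization with values in an arbitrary measurable space can be replaced by one with
`K + 1` values, without increasing the means or the objective. -/
theorem exists_feasible_finiteCost_le {K : ℕ} {ψ : ℕ → (Fin K → ℝ) → ℝ≥0}
    (hψ : ∀ t, Continuous (ψ t)) {b : ℝ} {𝒱 : Type*} [MeasurableSpace 𝒱] (P : Measure 𝒱)
    [IsProbabilityMeasure P] {e : 𝒱 → Fin K → ℝ} (he : Measurable e)
    (he01 : ∀ u, e u ∈ Set.Icc (0 : Fin K → ℝ) 1) (hb : ∀ k, ∫ u, e u k ∂P ≤ b) :
    ∃ θ ∈ feasibleRandomizations (K + 1) K b,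
      finiteCost ψ θ ≤ ∫⁻ u, ∑' t, (ψ t (e u) : ℝ≥0∞) ∂P := by
  set c := ∫⁻ u, ∑' t, (ψ t (e u) : ℝ≥0∞) ∂P with hc
  -- the feasible points whose objective, truncated at `T`, is at most `c`
  let A : ℕ → Set ((Fin (K + 1) → ℝ) × (Fin (K + 1) → Fin K → ℝ)) := fun T =>
    feasibleRandomizations (K + 1) K b ∩
      {θ | ∑ t ∈ Finset.range T, ENNReal.ofReal (∑ u, θ.1 u * ψ t (θ.2 u)) ≤ c}
  have hclosed : ∀ T, IsClosed {θ : (Fin (K + 1) → ℝ) × (Fin (K + 1) → Fin K → ℝ) |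
      ∑ t ∈ Finset.range T, ENNReal.ofReal (∑ u, θ.1 u * ψ t (θ.2 u)) ≤ c} := fun T =>
    isClosed_le (continuous_finsetSum _ fun t _ => ENNReal.continuous_ofReal.comp (by fun_prop))
      continuous_const
  have hcpt : ∀ T, IsCompact (A T) := fun T =>
    (isCompact_feasibleRandomizations _ _ _).inter_right (hclosed T)
  obtain ⟨θ, hθ⟩ := IsCompact.nonempty_iInter_of_sequence_nonempty_isCompact_isClosed A
    (fun T θ hθ => ⟨hθ.1, (Finset.sum_le_sum_of_subset
      (Finset.range_mono T.le_succ)).trans (show _ ≤ c from hθ.2)⟩)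
    (fun T => by
      obtain ⟨θ, hθ, h1, h2⟩ := integral_mem_epiHull
        (φ := fun x => ∑ t ∈ Finset.range T, (ψ t x : ℝ)) (by fun_prop) P he he01
      refine ⟨θ, ⟨hθ, fun k => ?_⟩, ?_⟩
      · have := congrFun h1 k
        simp only [Finset.sum_apply, Pi.smul_apply, smul_eq_mul] at this
        exact this.trans_le (hb k)
      · have hp : ∀ u, 0 ≤ θ.1 u := hθ.1.1
        calc ∑ t ∈ Finset.range T, ENNReal.ofReal (∑ u, θ.1 u * ψ t (θ.2 u))
            = ENNReal.ofReal (∑ u, θ.1 u * ∑ t ∈ Finset.range T, (ψ t (θ.2 u) : ℝ)) := by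
              rw [← ENNReal.ofReal_sum_of_nonneg
                (fun t _ => Finset.sum_nonneg fun u _ => mul_nonneg (hp u) NNReal.zero_le_coe),
                Finset.sum_comm]
              simp only [Finset.mul_sum]
          _ ≤ ENNReal.ofReal (∫ u, ∑ t ∈ Finset.range T, (ψ t (e u) : ℝ) ∂P) :=
              ENNReal.ofReal_le_ofReal h2
          _ ≤ ∫⁻ u, ENNReal.ofReal (∑ t ∈ Finset.range T, (ψ t (e u) : ℝ)) ∂P := by
              rw [integral_eq_lintegral_of_nonneg_ae
                (ae_of_all _ fun u => Finset.sum_nonneg fun t _ => NNReal.zero_le_coe)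
                (by fun_prop)]
              exact ENNReal.ofReal_toReal_le
          _ ≤ c := lintegral_mono fun u => by
              rw [ENNReal.ofReal_sum_of_nonneg fun t _ => NNReal.zero_le_coe]
              simp only [ENNReal.ofReal_coe_nnreal]
              exact ENNReal.sum_le_tsum _)
    (hcpt 0) (fun T => (hcpt T).isClosed)
  rw [Set.mem_iInter] at hθ
  exact ⟨θ, (hθ 0).1, ENNReal.tsum_le_of_sum_range_le fun T => (hθ T).2⟩

section

variable {K : ℕ} {X : Type*} {Y : Fin K → Type*} [∀ k, MeasurableSpace (Y k)]

theorem continuous_L [Finite X] [Nonempty X] (W : ∀ k, X → PMF (Y k))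
    (Q : ∀ k, Measure (ℕ → Y k)) (M : ℕ) (η : ℝ) (t : ℕ) : Continuous (L W Q M η t) := by
  have := Fintype.ofFinite (Fin t → X)
  unfold L
  simp only [← Finset.sup'_univ_eq_ciSup]
  exact Continuous.finset_sup'_apply _ fun x _ => by fun_prop

/-- A point of the minimization problem on `Fin (K + 1)` in coordinates. -/
theorem finiteCost_mem_converseValues (W : ∀ k, X → PMF (Y k)) (Q : ∀ k, Measure (ℕ → Y k))
    (M : ℕ) (η ε : ℝ) {N : ℕ} {θ : (Fin N → ℝ) × (Fin N → Fin K → ℝ)}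
    (hθ : θ ∈ feasibleRandomizations N K (ε + η)) :
    finiteCost (fun t e => (1 - L W Q M η t e).toNNReal) θ ∈
      converseValues W Q M η ε (Fin N) := by
  obtain ⟨⟨⟨hp, hp1⟩, he⟩, hb⟩ := hθ
  refine ⟨∑ u, ENNReal.ofReal (θ.1 u) • Measure.dirac u, θ.2, ⟨?_⟩, .of_discrete,
    fun u k => ⟨(he u trivial).1 k, (he u trivial).2 k⟩, fun k => ?_, ?_⟩
  · simp [← ENNReal.ofReal_sum_of_nonneg fun u _ => hp u, hp1]
  · rw [integral_finsetSum_measure fun u _ =>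
      (integrable_dirac (by finiteness)).smul_measure ENNReal.ofReal_ne_top]
    simpa [integral_smul_measure, ENNReal.toReal_ofReal, hp] using hb k
  · simp only [lintegral_finsetSum_measure, lintegral_smul_measure, lintegral_dirac, smul_eq_mul,
      ← ENNReal.tsum_mul_left, finiteCost]
    rw [← Summable.tsum_finsetSum fun _ _ => ENNReal.summable]
    refine tsum_congr fun t => ?_
    rw [ENNReal.ofReal_sum_of_nonneg fun u _ => mul_nonneg (hp u) NNReal.zero_le_coe]
    refine Finset.sum_congr rfl fun u _ => ?_
    rw [ENNReal.ofReal_mul (hp u), ENNReal.ofReal_coe_nnreal]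
    rfl

/-- Once the problem is feasible, a minimum over the feasible points in coordinates exists. -/
theorem exists_mem_converseValues_forall_le [Finite X] [Nonempty X] (W : ∀ k, X → PMF (Y k))
    (Q : ∀ k, Measure (ℕ → Y k)) (M : ℕ) (η ε : ℝ)
    (hne : (feasibleRandomizations (K + 1) K (ε + η)).Nonempty) :
    ∃ v ∈ converseValues W Q M η ε (Fin (K + 1)),
      ∀ θ ∈ feasibleRandomizations (K + 1) K (ε + η),
        v ≤ finiteCost (fun t e => (1 - L W Q M η t e).toNNReal) θ := by
  obtain ⟨θ, hθ, hmin⟩ := LowerSemicontinuousOn.exists_isMinOn hne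
    (isCompact_feasibleRandomizations _ _ _)
    ((lowerSemicontinuous_finiteCost (N := K + 1)
      (ψ := fun t e => (1 - L W Q M η t e).toNNReal) fun t =>
        continuous_real_toNNReal.comp
          (continuous_const.sub (continuous_L W Q M η t))).lowerSemicontinuousOn _)
  exact ⟨_, finiteCost_mem_converseValues W Q M η ε hθ, hmin⟩

/-- Every value of the problem with arbitrary randomization dominates a value with `K + 1`
points. -/
theorem exists_finiteCost_le_of_mem_converseValues [Finite X] [Nonempty X]
    (W : ∀ k, X → PMF (Y k)) (Q : ∀ k, Measure (ℕ → Y k)) (M : ℕ) (η ε : ℝ) {𝒱 : Type*}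
    [MeasurableSpace 𝒱] {v : ℝ≥0∞} (hv : v ∈ converseValues W Q M η ε 𝒱) :
    ∃ θ ∈ feasibleRandomizations (K + 1) K (ε + η),
      finiteCost (fun t e => (1 - L W Q M η t e).toNNReal) θ ≤ v := by
  obtain ⟨P, e, _, he, he01, hb, rfl⟩ := hv
  exact exists_feasible_finiteCost_le (fun t => continuous_real_toNNReal.comp
    (continuous_const.sub (continuous_L W Q M η t))) P he
    (fun u => ⟨fun k => (he01 u k).1, fun k => (he01 u k).2⟩) hb

end

/-! ### Stopping times of a sequence over a finite alphabet -/

section Sequence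

variable {B : Type*}

/-- The first `n` entries of a sequence. -/
def initial (n : ℕ) (z : ℕ → B) : Fin n → B := fun i => z i

/-- `σ` is a stopping time of the sequence: whether `σ = n` is determined by the first `n`
entries. -/
def IsSequenceStopping (σ : (ℕ → B) → ℕ∞) : Prop :=
  ∀ n : ℕ, ∃ C : Set (Fin n → B), ∀ z, σ z = n ↔ initial n z ∈ C

theorem initial_preimage_singleton {n : ℕ} (y : Fin n → B) :
    initial n ⁻¹' {y} = {z | ∀ i : Fin n, z i = y i} := by
  ext z
  simp [initial, funext_iff]

variable [MeasurableSpace B]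

theorem measurable_initial (n : ℕ) : Measurable (initial n : (ℕ → B) → Fin n → B) := by
  unfold initial
  fun_prop

variable [MeasurableSingletonClass B]

theorem prefixProb_infinitePi (p : ℕ → PMF B) {n : ℕ} (y : Fin n → B) :
    prefixProb (Measure.infinitePi fun i => (p i).toMeasure) y = ∏ i : Fin n, p i (y i) := by
  classical
  have h : {z : ℕ → B | ∀ i : Fin n, z i = y i} =
      Set.pi (Finset.range n) fun i => if h : i < n then {y ⟨i, h⟩} else Set.univ := by
    ext z
    simp only [Set.mem_ofPred_eq, Set.mem_pi, Finset.mem_coe, Finset.mem_range]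
    exact ⟨fun h i hi => by simpa [hi] using h ⟨i, hi⟩, fun h i => by simpa using h i i.2⟩
  rw [prefixProb, h, Measure.infinitePi_pi]
  · rw [Finset.prod_range]
    simp [PMF.toMeasure_apply_singleton]
  · intro i _
    split_ifs <;> simp

variable [Finite B]

theorem map_initial_infinitePi (p : ℕ → PMF B) (n : ℕ) :
    (Measure.infinitePi fun i => (p i).toMeasure).map (initial n) =
      Measure.pi fun i : Fin n => (p i).toMeasure := by
  refine Measure.ext_of_singleton fun y => ?_
  rw [Measure.map_apply (measurable_initial n) (measurableSet_singleton y), Measure.pi_singleton,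
    initial_preimage_singleton]
  simpa [PMF.toMeasure_apply_singleton, prefixProb] using prefixProb_infinitePi p y

theorem measurableSet_initial_mem {n : ℕ} (C : Set (Fin n → B)) :
    MeasurableSet (initial n ⁻¹' C) :=
  measurable_initial n C.toFinite.measurableSet

theorem IsSequenceStopping.measurableSet_exists {σ : (ℕ → B) → ℕ∞} (hσ : IsSequenceStopping σ)
    (p : ∀ n : ℕ, (Fin n → B) → Prop) :
    MeasurableSet {z | ∃ n : ℕ, σ z = n ∧ p n (initial n z)} := by
  rw [Set.ofPred_exists]
  refine .iUnion fun n => ?_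
  obtain ⟨C, hC⟩ := hσ n
  simp only [hC]
  exact measurableSet_initial_mem (C ∩ {y | p n y})

theorem IsSequenceStopping.measurableSet_le {σ : (ℕ → B) → ℕ∞} (hσ : IsSequenceStopping σ)
    (t : ℕ) : MeasurableSet {z | σ z ≤ t} := by
  convert hσ.measurableSet_exists fun n _ => n ≤ t using 1
  ext z
  constructor
  · intro h
    obtain ⟨n, hn⟩ := ENat.ne_top_iff_exists.1 (ne_top_of_le_ne_top (ENat.natCast_ne_top t) h)
    exact ⟨n, hn.symm, by simpa [← hn] using h⟩
  · rintro ⟨n, hn, hnt⟩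
    simpa [hn] using hnt

/-- Change of measure at a stopping time: if at the stopping time the likelihood ratio of `μ`
with respect to `ν` is at most `c` throughout an event, then so is the ratio of its
probabilities. -/
theorem IsSequenceStopping.measure_le {σ : (ℕ → B) → ℕ∞} (hσ : IsSequenceStopping σ)
    (μ ν : Measure (ℕ → B)) (c : ℝ≥0∞) (p : ∀ n : ℕ, (Fin n → B) → Prop)
    (hp : ∀ n y, p n y → prefixProb μ y ≤ c * prefixProb ν y) :
    μ {z | ∃ n : ℕ, σ z = n ∧ p n (initial n z)} ≤
      c * ν {z | ∃ n : ℕ, σ z = n ∧ p n (initial n z)} := by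
  classical
  have := Fintype.ofFinite B
  choose C hC using hσ
  have hset : {z | ∃ n : ℕ, σ z = n ∧ p n (initial n z)} =
      ⋃ n, initial n ⁻¹' (C n ∩ {y | p n y}) := by
    ext z
    simp [hC]
  have hdisj : Pairwise (Function.onFun Disjoint
      fun n => (initial n ⁻¹' (C n ∩ {y | p n y}) : Set (ℕ → B))) := by
    intro m n hmn
    refine Set.disjoint_left.2 fun z hm hn => hmn ?_
    exact_mod_cast ((hC m z).2 hm.1).symm.trans ((hC n z).2 hn.1)
  rw [hset, measure_iUnion hdisj fun n => measurableSet_initial_mem _,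
    measure_iUnion hdisj fun n => measurableSet_initial_mem _, ← ENNReal.tsum_mul_left]
  refine ENNReal.tsum_le_tsum fun n => ?_
  have hs : ((C n ∩ {y | p n y}).toFinset : Set (Fin n → B)) = C n ∩ {y | p n y} := by simp
  rw [← hs, ← sum_measure_preimage_singleton _ fun y _ => measurableSet_initial_mem _,
    ← sum_measure_preimage_singleton _ fun y _ => measurableSet_initial_mem _, Finset.mul_sum]
  refine Finset.sum_le_sum fun y hy => ?_
  rw [initial_preimage_singleton]
  exact hp n y (Set.mem_toFinset.1 hy).2

end Sequence

/-- The tail sum formula for the mean of a supremum, in the direction `≤`. -/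
theorem tsum_one_sub_measure_le {Ω ι : Type*} [MeasurableSpace Ω] (P : Measure Ω)
    [IsProbabilityMeasure P] (σ : ι → Ω → ℕ∞)
    (hσ : ∀ t : ℕ, MeasurableSet {ω | ∀ k, σ k ω ≤ t}) :
    ∑' t : ℕ, (1 - P {ω | ∀ k, σ k ω ≤ t}) ≤ ∫⁻ ω, ⨆ k, (σ k ω : ℝ≥0∞) ∂P := by
  simp only [← prob_compl_eq_one_sub (hσ _)]
  simp only [← lintegral_indicator_one (hσ _).compl]
  rw [← lintegral_tsum fun t => (measurable_one.indicator (hσ t).compl).aemeasurable]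
  refine lintegral_mono fun ω => ENNReal.tsum_le_of_sum_range_le fun N => ?_
  induction N with
  | zero => simp
  | succ N ih =>
    by_cases h : ∀ k, σ k ω ≤ N
    · rw [Finset.sum_range_succ, Set.indicator_of_notMem (by simpa using h), add_zero]
      exact ih
    · push Not at h
      obtain ⟨k, hk⟩ := h
      calc ∑ t ∈ Finset.range (N + 1), {ω | ∀ k, σ k ω ≤ t}ᶜ.indicator (1 : Ω → ℝ≥0∞) ω
          ≤ ∑ t ∈ Finset.range (N + 1), 1 :=
            Finset.sum_le_sum fun t _ => Set.indicator_le_self' (by simp) ω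
        _ = (((N + 1 : ℕ) : ℕ∞) : ℝ≥0∞) := by simp
        _ ≤ (σ k ω : ℝ≥0∞) := by
            rw [ENat.toENNReal_le]
            exact_mod_cast Order.add_one_le_of_lt hk
        _ ≤ _ := le_iSup (fun k => (σ k ω : ℝ≥0∞)) k

/-! ### The converse for given common randomness and message -/

section Converse

variable {K : ℕ} {X : Type*} {Y : Fin K → Type*} [∀ k, MeasurableSpace (Y k)]

/-- In this direction the conventions for a vanishing `Q_k(yⁿ)` are harmless: below the threshold,
`Q_k(yⁿ) = 0` forces the numerator to vanish. -/
theorem channelProb_le_of_infoDensity_lt (W : ∀ k, X → PMF (Y k)) (Q : ∀ k, Measure (ℕ → Y k))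
    {M : ℕ} (hM : 0 < M) {η : ℝ} (hη : 0 < η) {k : Fin K} {n : ℕ} {x : Fin n → X} {y : Fin n → Y k}
    (h : infoDensity W Q k x y < ((Real.log M + Real.log η : ℝ) : EReal)) :
    channelProb W k x y ≤ ENNReal.ofReal (M * η) * prefixProb (Q k) y := by
  have hpos : (0 : ℝ) < M * η := by positivity
  rw [← Real.log_mul (by positivity) hη.ne', ← ENNReal.log_ofReal_of_pos hpos, infoDensity,
    ENNReal.log_lt_log_iff] at h
  exact (ENNReal.div_le_iff_le_mul (.inr ENNReal.ofReal_ne_top)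
    (.inr (ENNReal.ofReal_pos.2 hpos).ne')).1 h.le

/-- The event that receiver `k` stops while the information density of the input sequence `x` is
below the threshold `log M + log η`. -/
def stopsBelow (W : ∀ k, X → PMF (Y k)) (Q : ∀ k, Measure (ℕ → Y k)) (M : ℕ) (η : ℝ) (k : Fin K)
    (x : ℕ → X) (σ : (ℕ → Y k) → ℕ∞) : Set (ℕ → Y k) :=
  {z | ∃ n : ℕ, σ z = n ∧ infoDensity W Q k (initial n x) (initial n z) <
    ((Real.log M + Real.log η : ℝ) : EReal)}

variable [∀ k, Finite (Y k)] [∀ k, MeasurableSingletonClass (Y k)]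

/-- The law of the outputs of receiver `k` for the input sequence `x`. -/
def outputLaw (W : ∀ k, X → PMF (Y k)) (k : Fin K) (x : ℕ → X) : Measure (ℕ → Y k) :=
  Measure.infinitePi fun n => (W k (x n)).toMeasure

instance (W : ∀ k, X → PMF (Y k)) (k : Fin K) (x : ℕ → X) :
    IsProbabilityMeasure (outputLaw W k x) := by
  unfold outputLaw
  infer_instance

/-- A receiver that has stopped by time `t` has crossed the threshold by time `t` or has stopped
below it. -/
theorem outputLaw_stop_le (W : ∀ k, X → PMF (Y k)) (Q : ∀ k, Measure (ℕ → Y k)) (M : ℕ) (η : ℝ)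
    (k : Fin K) (x : ℕ → X) (σ : (ℕ → Y k) → ℕ∞) (t : ℕ) :
    (outputLaw W k x).real {z | σ z ≤ t} ≤ min 1 (crossingProb W Q M η k (initial t x) +
      (outputLaw W k x).real (stopsBelow W Q M η k x σ)) := by
  refine le_min measureReal_le_one ?_
  have hlaw : blockLaw W k (initial t x) = (outputLaw W k x).map (initial t) :=
    (map_initial_infinitePi (fun n => W k (x n)) t).symm
  rw [crossingProb, hlaw, map_measureReal_apply (measurable_initial t)
    (Set.toFinite _).measurableSet]
  refine (measureReal_mono (fun z hz => ?_)).trans (measureReal_union_le _ _)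
  have hz' : σ z ≤ t := hz
  obtain ⟨n, hn⟩ := ENat.ne_top_iff_exists.1 (ne_top_of_le_ne_top (ENat.natCast_ne_top t) hz')
  have hnt : n ≤ t := by simpa [← hn] using hz'
  by_cases h : infoDensity W Q k (initial n x) (initial n z) <
      ((Real.log M + Real.log η : ℝ) : EReal)
  · exact .inr ⟨n, hn.symm, h⟩
  · exact .inl ((not_lt.1 h).trans (le_iSup (fun n : Fin (t + 1) => infoDensity W Q k
      (Fin.take n (Nat.lt_succ_iff.mp n.isLt) (initial t x))
      (Fin.take n (Nat.lt_succ_iff.mp n.isLt) (initial t z))) ⟨n, Nat.lt_succ_of_le hnt⟩))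

theorem prod_outputLaw_stop_le_L [Finite X] (W : ∀ k, X → PMF (Y k))
    (Q : ∀ k, Measure (ℕ → Y k)) (M : ℕ) (η : ℝ) (x : ℕ → X) (σ : ∀ k, (ℕ → Y k) → ℕ∞) (t : ℕ) :
    ∏ k, (outputLaw W k x).real {z | σ k z ≤ t} ≤
      L W Q M η t fun k => (outputLaw W k x).real (stopsBelow W Q M η k x (σ k)) :=
  (Finset.prod_le_prod (fun _ _ => measureReal_nonneg)
    fun k _ => outputLaw_stop_le W Q M η k x (σ k) t).trans
    (le_ciSup (f := fun x' : Fin t → X => ∏ k, min 1 (crossingProb W Q M η k x' +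
      (outputLaw W k x).real (stopsBelow W Q M η k x (σ k)))) (Set.finite_range _).bddAbove
      (initial t x))

/-- Given the common randomness and the message, the mean of the largest stopping time: the
receivers stop independently of each other. -/
theorem tsum_le_lintegral_iSup [Finite X] (W : ∀ k, X → PMF (Y k))
    (Q : ∀ k, Measure (ℕ → Y k)) (M : ℕ) (η : ℝ) (x : ℕ → X) {σ : ∀ k, (ℕ → Y k) → ℕ∞}
    (hσ : ∀ k, IsSequenceStopping (σ k)) :
    ∑' t : ℕ, ENNReal.ofReal (1 - L W Q M η t
        fun k => (outputLaw W k x).real (stopsBelow W Q M η k x (σ k))) ≤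
      ∫⁻ y, ⨆ k, (σ k (y k) : ℝ≥0∞) ∂Measure.pi fun k => outputLaw W k x := by
  have hset : ∀ t : ℕ, {y : ∀ k, ℕ → Y k | ∀ k, σ k (y k) ≤ t} =
      Set.pi Set.univ fun k => {z | σ k z ≤ t} := fun t => by ext; simp
  refine le_trans (ENNReal.tsum_le_tsum fun t => ?_) (tsum_one_sub_measure_le _
    (fun k (y : ∀ k, ℕ → Y k) => σ k (y k)) fun t => ?_)
  · refine (ENNReal.ofReal_le_ofReal (sub_le_sub_left
      (prod_outputLaw_stop_le_L W Q M η x σ t) 1)).trans (le_of_eq ?_)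
    rw [hset, Measure.pi_pi, ENNReal.ofReal_sub _ (Finset.prod_nonneg fun _ _ => measureReal_nonneg),
      ENNReal.ofReal_one, ENNReal.ofReal_prod_of_nonneg fun _ _ => measureReal_nonneg]
    simp
  · rw [hset]
    exact .univ_pi fun k => (hσ k).measurableSet_le t

/-- The event that receiver `k` stops and decodes the message `j`. -/
def decodes {M : ℕ} {k : Fin K} (σ : (ℕ → Y k) → ℕ∞) (g : ∀ n, (Fin n → Y k) → Fin M)
    (j : Fin M) : Set (ℕ → Y k) :=
  {z | ∃ n : ℕ, σ z = n ∧ g n (initial n z) = j}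

/-- Below the threshold a receiver either fails to decode `j`, or decodes it in an event where the
measure can be changed to `Q k`. -/
theorem outputLaw_stopsBelow_le (W : ∀ k, X → PMF (Y k)) (Q : ∀ k, Measure (ℕ → Y k))
    {M : ℕ} (hM : 0 < M) {η : ℝ} (hη : 0 < η) (k : Fin K) (x : ℕ → X) {σ : (ℕ → Y k) → ℕ∞}
    (hσ : IsSequenceStopping σ) (g : ∀ n, (Fin n → Y k) → Fin M) (j : Fin M) :
    outputLaw W k x (stopsBelow W Q M η k x σ) ≤
      outputLaw W k x (decodes σ g j)ᶜ + ENNReal.ofReal (M * η) * Q k (decodes σ g j) := by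
  let p : ∀ n, (Fin n → Y k) → Prop := fun n y => infoDensity W Q k (initial n x) y <
    ((Real.log M + Real.log η : ℝ) : EReal) ∧ g n y = j
  have hsub : stopsBelow W Q M η k x σ ⊆
      (decodes σ g j)ᶜ ∪ {z | ∃ n : ℕ, σ z = n ∧ p n (initial n z)} := by
    rintro z ⟨n, hn, hlt⟩
    by_cases h : g n (initial n z) = j
    · exact .inr ⟨n, hn, hlt, h⟩
    · refine .inl ?_
      rintro ⟨m, hm, hj⟩
      obtain rfl : m = n := by exact_mod_cast hm.symm.trans hn
      exact h hj
  refine (measure_mono hsub).trans ((measure_union_le _ _).trans (add_le_add_right ?_ _))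
  refine (hσ.measure_le _ (Q k) (ENNReal.ofReal (M * η)) p fun n y hy => ?_).trans ?_
  · rw [outputLaw, prefixProb_infinitePi]
    exact channelProb_le_of_infoDensity_lt W Q hM hη hy.1
  · gcongr
    rintro z ⟨n, hn, -, hj⟩
    exact ⟨n, hn, hj⟩

theorem IsSequenceStopping.measurableSet_decodes {M : ℕ} {k : Fin K} {σ : (ℕ → Y k) → ℕ∞}
    (hσ : IsSequenceStopping σ) (g : ∀ n, (Fin n → Y k) → Fin M) (j : Fin M) :
    MeasurableSet (decodes σ g j) :=
  hσ.measurableSet_exists fun n y => g n y = j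

theorem sum_measure_decodes_le {M : ℕ} {k : Fin K} (ν : Measure (ℕ → Y k))
    [IsProbabilityMeasure ν] {σ : (ℕ → Y k) → ℕ∞} (hσ : IsSequenceStopping σ)
    (g : ∀ n, (Fin n → Y k) → Fin M) : ∑ j, ν (decodes σ g j) ≤ 1 := by
  rw [← measure_univ (μ := ν)]
  refine sum_measure_le_measure_univ
    (fun j _ => (hσ.measurableSet_decodes g j).nullMeasurableSet) fun i _ j _ hij => ?_
  refine Disjoint.aedisjoint (Set.disjoint_left.2 ?_)
  rintro z ⟨n, hn, hi⟩ ⟨m, hm, hj⟩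
  obtain rfl : m = n := by exact_mod_cast hm.symm.trans hn
  exact hij (hi.symm.trans hj)

end Converse

section Code

/-! ### From a code to a feasible point -/

theorem sum_sum_weight {𝒰 : Type*} [Fintype 𝒰] {M : ℕ} (hM : 0 < M) (PU : PMF 𝒰) :
    ∑ u, ∑ _j : Fin M, PU u * (M : ℝ≥0∞)⁻¹ = 1 := by
  have h1 : ∑ u, PU u = 1 := by rw [← tsum_fintype (L := .unconditional 𝒰), PU.tsum_coe]
  simp only [Finset.sum_const, Finset.card_univ, Fintype.card_fin, nsmul_eq_mul]
  simp_rw [mul_left_comm (M : ℝ≥0∞), ENNReal.mul_inv_cancel (show (M : ℝ≥0∞) ≠ 0 by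
    exact_mod_cast hM.ne') (ENNReal.natCast_ne_top M), mul_one, h1]

variable {K : ℕ} {X : Type*} {Y : Fin K → Type*} [∀ k, MeasurableSpace (Y k)]
  {𝒰 : Type*} [Fintype 𝒰] [MeasurableSpace 𝒰]

theorem _root_.ENat.eq_of_forall_eq_natCast_iff {a b : ℕ∞} (h : ∀ n : ℕ, a = n ↔ b = n) :
    a = b := by
  induction a with
  | top =>
    induction b with
    | top => rfl
    | coe n => exact (h n).2 rfl
  | coe m => exact ((h m).1 rfl).symm

/-- A receiver's stopping time is, for each value of the common randomness, a stopping time of the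
output sequence of that receiver. -/
theorem VLSFCode.exists_sequenceStopping {W : ∀ k, X → PMF (Y k)} {ℓ : ℝ≥0} {M : ℕ} {ε : ℝ}
    [∀ k, Nonempty (Y k)] (hM : 0 < M)
    (code : VLSFCode W 𝒰 ℓ M ε) (k : Fin K) :
    ∃ σ : 𝒰 → (ℕ → Y k) → ℕ∞, (∀ u, IsSequenceStopping (σ u)) ∧
      ∀ u j y, code.τ k (u, j, y) = σ u (y k) := by
  have h : ∀ n : ℕ, ∃ C : Set (𝒰 × (Fin n → Y k)), ∀ ω,
      code.τ k ω = n ↔ observation 𝒰 M Y k n ω ∈ C := by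
    intro n
    obtain ⟨C, -, hC⟩ := (code.isStoppingTime k).measurableSet_eq_of_countable n
    exact ⟨C, fun ω => (Set.ext_iff.1 hC ω).symm⟩
  choose C hC using h
  -- the other outputs and the message do not matter
  let z₀ : ∀ k, ℕ → Y k := fun k _ => Classical.arbitrary (Y k)
  let σ : 𝒰 → (ℕ → Y k) → ℕ∞ := fun u z => code.τ k (u, ⟨0, hM⟩, Function.update z₀ k z)
  have hσ : ∀ u z (n : ℕ), σ u z = n ↔ (u, initial n z) ∈ C n := fun u z n => by
    simp only [σ, hC, observation, Function.update_self]
    rfl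
  exact ⟨σ, fun u n => ⟨{y | (u, y) ∈ C n}, fun z => hσ u z n⟩, fun u j y =>
    ENat.eq_of_forall_eq_natCast_iff fun n => by rw [hC, hσ]; rfl⟩

theorem codeLaw_eq (W : ∀ k, X → PMF (Y k)) (PU : PMF 𝒰) {M : ℕ} (f : ℕ → 𝒰 → Fin M → X) :
    codeLaw W PU f = ∑ u, ∑ j, (PU u * (M : ℝ≥0∞)⁻¹) •
      (Measure.pi fun k => outputLaw W k fun n => f n u j).map fun y => (u, j, y) := rfl

variable [∀ k, Finite (Y k)] [∀ k, MeasurableSingletonClass (Y k)]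

instance (W : ∀ k, X → PMF (Y k)) (PU : PMF 𝒰) {M : ℕ} (f : ℕ → 𝒰 → Fin M → X) :
    IsFiniteMeasure (codeLaw W PU f) := by
  rw [codeLaw_eq]
  refine ⟨?_⟩
  simp only [Measure.coe_finsetSum, Finset.sum_apply, Measure.smul_apply, smul_eq_mul]
  refine ENNReal.sum_lt_top.2 fun u _ => ENNReal.sum_lt_top.2 fun j _ => ENNReal.mul_lt_top
    (ENNReal.mul_lt_top (PU.apply_lt_top u) (ENNReal.inv_lt_top.2 ?_)) (measure_lt_top _ _)
  exact_mod_cast j.pos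

variable [MeasurableSingletonClass 𝒰]

/-- Randomizing over the pair `(U, J)`, with `e_k` the probability that receiver `k` stops below
the threshold, gives a feasible point whose value is at most the mean stopping time. -/
theorem VLSFCode.exists_mem_converseValues_le [Finite X] [Nonempty X] {W : ∀ k, X → PMF (Y k)}
    (Q : ∀ k, Measure (ℕ → Y k)) [∀ k, IsProbabilityMeasure (Q k)] {M : ℕ} (hM : 0 < M) {η : ℝ}
    (hη : 0 < η) {ℓ : ℝ≥0} {ε : ℝ} (code : VLSFCode W 𝒰 ℓ M ε) :
    ∃ v ∈ converseValues W Q M η ε (𝒰 × Fin M), v ≤ ℓ := by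
  have hY : ∀ k, Nonempty (Y k) := fun k => (W k (Classical.arbitrary X)).support_nonempty.to_type
  choose σ hσ hτ using code.exists_sequenceStopping hM
  let x : 𝒰 × Fin M → ℕ → X := fun s n => code.enc n s.1 s.2
  let e : 𝒰 × Fin M → Fin K → ℝ := fun s k =>
    (outputLaw W k (x s)).real (stopsBelow W Q M η k (x s) (σ k s.1))
  let w : 𝒰 → ℝ≥0∞ := fun u => code.PU u * (M : ℝ≥0∞)⁻¹
  let P : Measure (𝒰 × Fin M) := ∑ u, ∑ j, w u • Measure.dirac (u, j)
  have hP : ∀ F : 𝒰 × Fin M → ℝ≥0∞, ∫⁻ s, F s ∂P = ∑ u, ∑ j, w u * F (u, j) := fun F => by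
    simp only [P, lintegral_finsetSum_measure, lintegral_smul_measure, lintegral_dirac, smul_eq_mul]
  have hP1 : IsProbabilityMeasure P := ⟨by
    rw [← lintegral_one, hP]
    simpa [w] using sum_sum_weight hM code.PU⟩
  have he01 : ∀ s k, e s k ∈ Set.Icc (0 : ℝ) 1 := fun s k =>
    ⟨measureReal_nonneg, measureReal_le_one⟩
  refine ⟨_, ⟨P, e, hP1, .of_discrete, he01, fun k => ?_, rfl⟩, ?_⟩
  · let g : 𝒰 → ∀ n, (Fin n → Y k) → Fin M := fun u n y => code.dec k n (u, y)
    have hε : 0 ≤ ε := measureReal_nonneg.trans (code.error_le k)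
    have herr : ∑ u, ∑ j, w u * outputLaw W k (x (u, j)) (decodes (σ k u) (g u) j)ᶜ ≤
        ENNReal.ofReal ε := by
      refine le_trans ?_ ((ENNReal.le_ofReal_iff_toReal_le (measure_ne_top _ _) hε).2
        (code.error_le k))
      rw [codeLaw_eq]
      simp only [Measure.coe_finsetSum, Finset.sum_apply, Measure.smul_apply, smul_eq_mul]
      refine Finset.sum_le_sum fun u _ => Finset.sum_le_sum fun j _ =>
        mul_le_mul_right (le_trans ?_ (Measure.le_map_apply (by fun_prop) _)) _
      rw [← (measurePreserving_eval (fun k => outputLaw W k (x (u, j))) k).measure_preimage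
        ((hσ k u).measurableSet_decodes (g u) j).compl.nullMeasurableSet]
      refine measure_mono fun y hy => ?_
      simp only [Set.mem_preimage, Set.mem_ofPred_eq, hτ]
      exact hy
    have hchange : ∑ u, ∑ j, w u * (ENNReal.ofReal (M * η) * Q k (decodes (σ k u) (g u) j)) ≤
        ENNReal.ofReal η := by
      have hM0 : (M : ℝ≥0∞) ≠ 0 := by exact_mod_cast hM.ne'
      calc ∑ u, ∑ j, w u * (ENNReal.ofReal (M * η) * Q k (decodes (σ k u) (g u) j))
          ≤ ∑ u, w u * ENNReal.ofReal (M * η) := Finset.sum_le_sum fun u _ => by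
            simp only [← mul_assoc, ← Finset.mul_sum]
            exact mul_le_of_le_one_right' (sum_measure_decodes_le (Q k) (hσ k u) (g u))
        _ = ENNReal.ofReal η * ∑ u, ∑ _j : Fin M, w u := by
            rw [ENNReal.ofReal_mul (Nat.cast_nonneg M), ENNReal.ofReal_natCast, ← Finset.sum_mul]
            simp only [Finset.sum_const, Finset.card_univ, Fintype.card_fin, nsmul_eq_mul,
              ← Finset.mul_sum]
            ring
        _ = ENNReal.ofReal η := by rw [sum_sum_weight hM, mul_one]
    rw [integral_eq_lintegral_of_nonneg_ae (ae_of_all _ fun s => (he01 s k).1)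
      Measurable.of_discrete.aestronglyMeasurable]
    refine ENNReal.toReal_le_of_le_ofReal (by linarith) ?_
    rw [hP, ENNReal.ofReal_add hε hη.le]
    refine le_trans ?_ (add_le_add herr hchange)
    simp only [← Finset.sum_add_distrib, ← mul_add]
    refine Finset.sum_le_sum fun u _ => Finset.sum_le_sum fun j _ => mul_le_mul_right ?_ _
    rw [ofReal_measureReal]
    exact outputLaw_stopsBelow_le W Q hM hη k (x (u, j)) (hσ k u) (g u) j
  · refine le_trans ?_ code.average_le
    rw [hP, codeLaw_eq]
    simp only [lintegral_finsetSum_measure, lintegral_smul_measure, smul_eq_mul]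
    refine Finset.sum_le_sum fun u _ => Finset.sum_le_sum fun j _ => mul_le_mul_right ?_ _
    have hemb : MeasurableEmbedding fun y : ∀ k, ℕ → Y k => (u, j, y) :=
      .prodMk_left u (.prodMk_left j .id)
    rw [hemb.lintegral_map]
    simp only [hτ]
    exact tsum_le_lintegral_iSup W Q M η (x (u, j)) fun k => hσ k u

end Code

end CMDMBC

end

theorem theorem2 {K : ℕ} {X : Type*} {Y : Fin K → Type*} [Fintype X] [Nonempty X]
    [∀ k, Fintype (Y k)] [∀ k, MeasurableSpace (Y k)] [∀ k, MeasurableSingletonClass (Y k)]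
    (W : ∀ k, X → PMF (Y k))
    (Q : ∀ k, Measure (ℕ → Y k)) [∀ k, IsProbabilityMeasure (Q k)]
    (M : ℕ) (hM : 0 < M) (η : ℝ) (hη : 0 < η)
    {𝒰 : Type*} [Fintype 𝒰] [MeasurableSpace 𝒰] [MeasurableSingletonClass 𝒰]
    (ℓ : ℝ≥0) (ε : ℝ) (code : CMDMBC.VLSFCode W 𝒰 ℓ M ε) :
    ∃ v : ℝ≥0∞,
      IsLeast (CMDMBC.converseValues W Q M η ε (Fin (K + 1))) v ∧
      (∀ (𝒱 : Type*) [MeasurableSpace 𝒱],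
        v ∈ lowerBounds (CMDMBC.converseValues W Q M η ε 𝒱)) ∧
      v ≤ ℓ := by
  obtain ⟨c, hc, hcℓ⟩ := code.exists_mem_converseValues_le Q hM hη
  obtain ⟨θ, hθ, hθc⟩ := CMDMBC.exists_finiteCost_le_of_mem_converseValues W Q M η ε hc
  obtain ⟨v, hv, hmin⟩ := CMDMBC.exists_mem_converseValues_forall_le W Q M η ε ⟨θ, hθ⟩
  have hlow : ∀ (𝒱 : Type _) [MeasurableSpace 𝒱],
      v ∈ lowerBounds (CMDMBC.converseValues W Q M η ε 𝒱) := fun 𝒱 _ c' hc' => by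
    obtain ⟨θ', hθ', hle⟩ := CMDMBC.exists_finiteCost_le_of_mem_converseValues W Q M η ε hc'
    exact (hmin θ' hθ').trans hle
  refine ⟨v, ⟨hv, fun c' hc' => ?_⟩, hlow, (hmin θ hθ).trans (hθc.trans hcℓ)⟩
  obtain ⟨θ', hθ', hle⟩ := CMDMBC.exists_finiteCost_le_of_mem_converseValues W Q M η ε hc'
  exact (hmin θ' hθ').trans hle
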